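/- Let $n\ge 2$ be an integer and $p\in(0,2]$. Let $|\cdot|$ be the Euclidean norm on $\mathbb{R}^n$ and let $\sigma$ be the rotation-invariant surface measure on the unit sphere $S^{n-1}\subset\mathbb{R}^n$, normalized so that $\sigma(S^{n-1})=1$. If $\lambda$ is a real number with $\lambda\le\frac{n+p-2}{n}$, then $$\int_{S^{n-1}}|x-az|^p\,d\sigma(z)\ \ge\ \left(|x|^2+\lambda a^2\right)^{p/2}$$ for all $x\in\mathbb{R}^n$ and all real $a\ge 0$ with $|x|^2+\lambda a^2\ge 0$ (a condition which is automatic when $\lambda\ge 0$). Moreover, $\frac{n+p-2}{n}$ is the best constant, that is, the largest real number $\lambda$ for which this inequality holds for all such $x$ and $a$. -/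

import Mathlib

open MeasureTheory Metric

/-- The normalized (rotation invariant) surface measure on the unit sphere of `ℝⁿ`. -/
noncomputable def normalizedSphereMeasure (n : ℕ) :
    Measure (sphere (0 : EuclideanSpace ℝ (Fin n)) 1) :=
  ((volume : Measure (EuclideanSpace ℝ (Fin n))).toSphere Set.univ)⁻¹ •
    (volume : Measure (EuclideanSpace ℝ (Fin n))).toSphere

/-- The inequality `∫ |x - a z|ᵖ dσ(z) ≥ (|x|² + lam a²)^(p/2)` holds for all `x ∈ ℝⁿ` and `a ≥ 0`
for which the right-hand side is meaningful, that is, for which `|x|² + lam a² ≥ 0`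
(for `lam ≥ 0` these are all `x` and `a ≥ 0`). -/
def SphericalConvexityInequality (n : ℕ) (p lam : ℝ) : Prop :=
  ∀ (x : EuclideanSpace ℝ (Fin n)) (a : ℝ), 0 ≤ a → 0 ≤ ‖x‖ ^ 2 + lam * a ^ 2 →
    (‖x‖ ^ 2 + lam * a ^ 2) ^ (p / 2) ≤
      ∫ z : sphere (0 : EuclideanSpace ℝ (Fin n)) 1,
        ‖x - a • (z : EuclideanSpace ℝ (Fin n))‖ ^ p ∂(normalizedSphereMeasure n)

/-!
The mean `∫ |x - a z|ᵖ dσ(z)` depends only on `|x|` and `a`, is symmetric in them and homogeneous of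
degree `p`. Since the constant `lam = (n + p - 2) / n` is at most `1`, it is enough to treat
`x = eᵢ` and `0 ≤ a ≤ 1`, that is, to bound `M(a) = ∫ (1 + a² - 2 a zᵢ) ^ q dσ(z)`, with
`q = p / 2`, from below by `(1 + lam a²) ^ q`.

The claim is that `M(a) / (1 + lam a²) ^ q`, which is `1` at `a = 0`, is monotone on `[0, 1)`. Its
derivative is a positive multiple of the defect
`D(a) = ∫ ((1 - lam) a - (1 - lam a²) zᵢ) (1 + a² - 2 a zᵢ) ^ (q - 1) dσ(z)` (`zonalDefect`).
Invariance of `σ` under reflections gives the integration by parts formula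
`(n - 1) ∫ zᵢ f(zᵢ) dσ = ∫ (1 - zᵢ²) f'(zᵢ) dσ` (`integral_sphere_zonal_by_parts`). It yields a
second order linear differential equation for `M`, which, for this particular `lam`, becomes
`a (1 - a²) (1 + lam a²) D' = -P D + Q M` with `P > 0` and `Q ≥ 0`
(`exists_hasDerivAt_zonalDefect`). As `D(0) = 0`, such a `D` cannot become negative
(`zonalDefect_nonneg`). The endpoint `a = 1`, where `1 + a² - 2 a zᵢ` can vanish, follows
by continuity.

The constant is optimal because `M(a) = 1 + (p / 2) ((n + p - 2) / n) a² + o(a²)` as `a → 0`, while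
the other side is `1 + (p / 2) lam a² + o(a²)` (`le_of_sphericalConvexityInequality`).
-/

/-! ### Invariance of the sphere measure -/

lemma measurePreserving_sphere_linearIsometryEquiv {n : ℕ}
    (L : EuclideanSpace ℝ (Fin n) ≃ₗᵢ[ℝ] EuclideanSpace ℝ (Fin n)) :
    MeasurePreserving
      (fun z : sphere (0 : EuclideanSpace ℝ (Fin n)) 1 ↦
        (⟨L z, by simp⟩ : sphere (0 : EuclideanSpace ℝ (Fin n)) 1))
      (normalizedSphereMeasure n) (normalizedSphereMeasure n) := by
  have hm : Measurable (fun z : sphere (0 : EuclideanSpace ℝ (Fin n)) 1 ↦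
      (⟨L z, by simp⟩ : sphere (0 : EuclideanSpace ℝ (Fin n)) 1)) :=
    (L.continuous.measurable.comp measurable_subtype_coe).subtype_mk
  suffices h : MeasurePreserving
      (fun z : sphere (0 : EuclideanSpace ℝ (Fin n)) 1 ↦
        (⟨L z, by simp⟩ : sphere (0 : EuclideanSpace ℝ (Fin n)) 1))
      (volume : Measure (EuclideanSpace ℝ (Fin n))).toSphere
      (volume : Measure (EuclideanSpace ℝ (Fin n))).toSphere from
    h.smul_measure _
  refine ⟨hm, ?_⟩
  ext s hs
  rw [Measure.map_apply hm hs, Measure.toSphere_apply' _ (hm hs), Measure.toSphere_apply' _ hs]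
  congr 1
  conv_rhs => rw [← L.measurePreserving.measure_preimage_emb L.toHomeomorph.measurableEmbedding]
  congr 1
  ext y
  simp only [Set.mem_smul, Set.mem_image, Set.mem_preimage, Subtype.exists, exists_and_right,
    exists_eq_right]
  constructor
  · rintro ⟨r, hr, z, ⟨hz, hzs⟩, rfl⟩
    exact ⟨r, hr, L z, ⟨by simpa using hz, hzs⟩, by simp⟩
  · rintro ⟨r, hr, w, ⟨hw, hws⟩, hy⟩
    refine ⟨r, hr, L.symm w, ⟨by simpa using hw, by simpa using hws⟩, ?_⟩
    rw [← map_smul, hy, L.symm_apply_apply]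

lemma integral_sphere_comp_linearIsometryEquiv {n : ℕ}
    (L : EuclideanSpace ℝ (Fin n) ≃ₗᵢ[ℝ] EuclideanSpace ℝ (Fin n))
    {g : EuclideanSpace ℝ (Fin n) → ℝ}
    (hg : Continuous fun z : sphere (0 : EuclideanSpace ℝ (Fin n)) 1 ↦ g z) :
    ∫ z : sphere (0 : EuclideanSpace ℝ (Fin n)) 1, g (L z) ∂normalizedSphereMeasure n =
      ∫ z : sphere (0 : EuclideanSpace ℝ (Fin n)) 1, g z ∂normalizedSphereMeasure n := by
  have h := measurePreserving_sphere_linearIsometryEquiv L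
  conv_rhs => rw [← h.map_eq]
  rw [integral_map h.measurable.aemeasurable hg.aestronglyMeasurable]

lemma isProbabilityMeasure_normalizedSphereMeasure {n : ℕ} (hn : 1 ≤ n) :
    IsProbabilityMeasure (normalizedSphereMeasure n) := by
  have : Nonempty (Fin n) := ⟨⟨0, hn⟩⟩
  constructor
  rw [normalizedSphereMeasure, Measure.smul_apply, smul_eq_mul]
  exact ENNReal.inv_mul_cancel (Measure.measure_univ_ne_zero.2 (Measure.toSphere_ne_zero _))
    (measure_ne_top _ _)

instance isFiniteMeasure_normalizedSphereMeasure (n : ℕ) :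
    IsFiniteMeasure (normalizedSphereMeasure n) := by
  rcases Nat.eq_zero_or_pos n with rfl | hn
  · have : (volume : Measure (EuclideanSpace ℝ (Fin 0))).toSphere = 0 := by
      rw [Measure.toSphere_eq_zero_iff_finrank]; simp
    rw [normalizedSphereMeasure, this]
    simp only [smul_zero]
    infer_instance
  · have := isProbabilityMeasure_normalizedSphereMeasure hn
    infer_instance

/-! ### Differentiation under the integral sign over a compact space -/

/-- The domination hypothesis comes from compactness, so continuity of the derivative in both
variables is enough. -/
lemma hasDerivAt_integral_of_compactSpace {Z : Type*} [TopologicalSpace Z] [CompactSpace Z]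
    [MeasurableSpace Z] [OpensMeasurableSpace Z] (μ : Measure Z) [IsFiniteMeasure μ]
    {g g' : ℝ → Z → ℝ} {U : Set ℝ} (hU : IsOpen U) (hg : ∀ a ∈ U, Continuous (g a))
    (hd : ∀ a ∈ U, ∀ z, HasDerivAt (fun b ↦ g b z) (g' a z) a)
    (hc : ContinuousOn (Function.uncurry g') (U ×ˢ Set.univ)) {a : ℝ} (ha : a ∈ U) :
    HasDerivAt (fun b ↦ ∫ z, g b z ∂μ) (∫ z, g' a z ∂μ) a := by
  obtain ⟨K, hK, haK, hKU⟩ := exists_compact_subset hU ha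
  obtain ⟨C, hC⟩ := (hK.prod (isCompact_univ (X := Z))).exists_bound_of_continuousOn
    (hc.mono (Set.prod_mono hKU subset_rfl))
  have hcont : ∀ b ∈ U, Continuous (g' b) := fun b hb ↦
    hc.comp_continuous (f := fun z ↦ (b, z)) (by fun_prop) fun z ↦ ⟨hb, trivial⟩
  refine (hasDerivAt_integral_of_dominated_loc_of_deriv_le (bound := fun _ ↦ C)
    (mem_interior_iff_mem_nhds.1 haK) ?_ ?_ ?_ ?_ (integrable_const C) ?_).2
  · filter_upwards [hU.mem_nhds ha] with b hb
    exact (hg b hb).aestronglyMeasurable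
  · exact (hg a ha).integrable_of_hasCompactSupport (HasCompactSupport.of_compactSpace _)
  · exact (hcont a ha).aestronglyMeasurable
  · exact .of_forall fun z b hb ↦ hC (b, z) ⟨hb, trivial⟩
  · exact .of_forall fun z b hb ↦ hd b (hKU hb) z

/-! ### Integration by parts for zonal functions -/

/-- The reflection of the plane of `eᵢ` and `eⱼ` that sends `eᵢ` to `cos φ eᵢ + sin φ eⱼ`, extended
by the identity on the orthogonal complement. It is the reflection in the hyperplane orthogonal to
`cos (φ / 2) eⱼ - sin (φ / 2) eᵢ`. -/
lemma exists_linearIsometryEquiv_coordinate_plane {n : ℕ} {i j : Fin n} (hij : i ≠ j) (φ : ℝ) :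
    ∃ L : EuclideanSpace ℝ (Fin n) ≃ₗᵢ[ℝ] EuclideanSpace ℝ (Fin n), ∀ z,
      L z i = z i * Real.cos φ + z j * Real.sin φ ∧
        L z j = z i * Real.sin φ - z j * Real.cos φ := by
  set v : EuclideanSpace ℝ (Fin n) :=
    EuclideanSpace.single j (Real.cos (φ / 2)) - EuclideanSpace.single i (Real.sin (φ / 2)) with hv
  have hinner : ∀ z, inner ℝ v z = Real.cos (φ / 2) * z j - Real.sin (φ / 2) * z i := by
    intro z
    simp [hv, inner_sub_left, EuclideanSpace.inner_single_left]
  have hvi : v i = -Real.sin (φ / 2) := by simp [hv, hij]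
  have hvj : v j = Real.cos (φ / 2) := by simp [hv, hij.symm]
  have hnorm : ‖v‖ ^ 2 = 1 := by
    rw [← real_inner_self_eq_norm_sq, hinner, hvi, hvj]
    linear_combination Real.sin_sq_add_cos_sq (φ / 2)
  have hc : Real.cos φ = 2 * Real.cos (φ / 2) ^ 2 - 1 := by
    rw [← Real.cos_two_mul]; ring_nf
  have hs : Real.sin φ = 2 * Real.sin (φ / 2) * Real.cos (φ / 2) := by
    rw [← Real.sin_two_mul]; ring_nf
  have hsq := Real.sin_sq_add_cos_sq (φ / 2)
  refine ⟨(Submodule.span ℝ {v})ᗮ.reflection, fun z ↦ ⟨?_, ?_⟩⟩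
  · rw [Submodule.reflection_orthogonal_apply, Submodule.reflection_singleton_apply]
    simp only [RCLike.ofReal_real_eq_id, id, hnorm, hinner, PiLp.neg_apply, PiLp.sub_apply,
      PiLp.smul_apply, hvi, smul_eq_mul, nsmul_eq_mul, hc, hs]
    push_cast
    linear_combination -2 * z i * hsq
  · rw [Submodule.reflection_orthogonal_apply, Submodule.reflection_singleton_apply]
    simp only [RCLike.ofReal_real_eq_id, id, hnorm, hinner, PiLp.neg_apply, PiLp.sub_apply,
      PiLp.smul_apply, hvj, smul_eq_mul, nsmul_eq_mul, hc, hs]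
    push_cast
    ring

lemma sphere_coord_mem_Icc {n : ℕ} (z : sphere (0 : EuclideanSpace ℝ (Fin n)) 1) (i : Fin n) :
    (z : EuclideanSpace ℝ (Fin n)) i ∈ Set.Icc (-1 : ℝ) 1 := by
  have h := PiLp.norm_apply_le (z : EuclideanSpace ℝ (Fin n)) i
  rw [norm_eq_of_mem_sphere, Real.norm_eq_abs] at h
  exact abs_le.1 h

/-- Infinitesimal form of the invariance of `σ`: the integral of `z ↦ zⱼ f(zᵢ)` composed with the
reflection of angle `φ` in the plane of `eᵢ` and `eⱼ` does not depend on `φ`, so its derivative at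
`φ = 0` vanishes. -/
lemma integral_sphere_coord_mul_eq_integral_sq_mul_deriv {n : ℕ} {i j : Fin n} (hij : i ≠ j)
    {f f' : ℝ → ℝ} (hf : ∀ t ∈ Set.Icc (-1 : ℝ) 1, HasDerivAt f (f' t) t)
    (hf' : ContinuousOn f' (Set.Icc (-1) 1)) :
    ∫ z : sphere (0 : EuclideanSpace ℝ (Fin n)) 1,
        (z : EuclideanSpace ℝ (Fin n)) i * f ((z : EuclideanSpace ℝ (Fin n)) i)
          ∂normalizedSphereMeasure n =
      ∫ z : sphere (0 : EuclideanSpace ℝ (Fin n)) 1,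
        (z : EuclideanSpace ℝ (Fin n)) j ^ 2 * f' ((z : EuclideanSpace ℝ (Fin n)) i)
          ∂normalizedSphereMeasure n := by
  choose L hL using exists_linearIsometryEquiv_coordinate_plane hij
  have hfc : ContinuousOn f (Set.Icc (-1) 1) := fun t ht ↦ (hf t ht).continuousAt.continuousWithinAt
  have hcoord : ∀ k : Fin n, Continuous fun z : sphere (0 : EuclideanSpace ℝ (Fin n)) 1 ↦
      (z : EuclideanSpace ℝ (Fin n)) k := fun k ↦ by fun_prop
  have hmem : ∀ (φ : ℝ) (z : sphere (0 : EuclideanSpace ℝ (Fin n)) 1),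
      (z : EuclideanSpace ℝ (Fin n)) i * Real.cos φ + (z : EuclideanSpace ℝ (Fin n)) j * Real.sin φ
        ∈ Set.Icc (-1 : ℝ) 1 := by
    intro φ z
    rw [← (hL φ z).1]
    exact sphere_coord_mem_Icc ⟨L φ z, by simp⟩ i
  have hderiv := hasDerivAt_integral_of_compactSpace (normalizedSphereMeasure n) (U := Set.univ)
    (g := fun φ z ↦ ((z : EuclideanSpace ℝ (Fin n)) i * Real.sin φ
      - (z : EuclideanSpace ℝ (Fin n)) j * Real.cos φ)
      * f ((z : EuclideanSpace ℝ (Fin n)) i * Real.cos φ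
        + (z : EuclideanSpace ℝ (Fin n)) j * Real.sin φ))
    (g' := fun φ z ↦ ((z : EuclideanSpace ℝ (Fin n)) i * Real.cos φ
      + (z : EuclideanSpace ℝ (Fin n)) j * Real.sin φ)
      * f ((z : EuclideanSpace ℝ (Fin n)) i * Real.cos φ
        + (z : EuclideanSpace ℝ (Fin n)) j * Real.sin φ) +
      ((z : EuclideanSpace ℝ (Fin n)) i * Real.sin φ
        - (z : EuclideanSpace ℝ (Fin n)) j * Real.cos φ)
      * (f' ((z : EuclideanSpace ℝ (Fin n)) i * Real.cos φ
        + (z : EuclideanSpace ℝ (Fin n)) j * Real.sin φ) *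
        (-((z : EuclideanSpace ℝ (Fin n)) i * Real.sin φ
        - (z : EuclideanSpace ℝ (Fin n)) j * Real.cos φ))))
    isOpen_univ ?_ ?_ ?_ (Set.mem_univ 0)
  · have hconst : ∀ φ : ℝ, ∫ z : sphere (0 : EuclideanSpace ℝ (Fin n)) 1,
        ((z : EuclideanSpace ℝ (Fin n)) i * Real.sin φ
          - (z : EuclideanSpace ℝ (Fin n)) j * Real.cos φ)
          * f ((z : EuclideanSpace ℝ (Fin n)) i * Real.cos φ
            + (z : EuclideanSpace ℝ (Fin n)) j * Real.sin φ) ∂normalizedSphereMeasure n =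
        ∫ z : sphere (0 : EuclideanSpace ℝ (Fin n)) 1,
          (z : EuclideanSpace ℝ (Fin n)) j * f ((z : EuclideanSpace ℝ (Fin n)) i)
            ∂normalizedSphereMeasure n := by
      intro φ
      rw [← integral_sphere_comp_linearIsometryEquiv (L φ) (g := fun z ↦ z j * f (z i))
        ((hcoord j).mul (hfc.comp_continuous (hcoord i) fun z ↦ sphere_coord_mem_Icc z i))]
      simp only [hL]
    simp only [hconst] at hderiv
    have h0 := hderiv.unique (hasDerivAt_const _ _)
    simp only [Real.cos_zero, Real.sin_zero, mul_one, mul_zero, add_zero, zero_sub, neg_neg] at h0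
    rw [integral_add] at h0
    · rw [eq_neg_of_add_eq_zero_left h0, ← integral_neg]
      congr 1 with z
      ring
    · exact ((hcoord i).mul (hfc.comp_continuous (hcoord i)
        fun z ↦ sphere_coord_mem_Icc z i)).integrable_of_hasCompactSupport
        (HasCompactSupport.of_compactSpace _)
    · exact ((hcoord j).neg.mul ((hf'.comp_continuous (hcoord i)
        fun z ↦ sphere_coord_mem_Icc z i).mul (hcoord j))).integrable_of_hasCompactSupport
        (HasCompactSupport.of_compactSpace _)
  · intro φ _
    exact (((hcoord i).mul_const _).sub ((hcoord j).mul_const _)).mul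
      (hfc.comp_continuous (((hcoord i).mul_const _).add ((hcoord j).mul_const _)) (hmem φ))
  · intro φ _ z
    have hs := (Real.hasDerivAt_sin φ)
    have hc := (Real.hasDerivAt_cos φ)
    have h1 := (hs.const_mul ((z : EuclideanSpace ℝ (Fin n)) i)).sub
      (hc.const_mul ((z : EuclideanSpace ℝ (Fin n)) j))
    have h2 := (hc.const_mul ((z : EuclideanSpace ℝ (Fin n)) i)).add
      (hs.const_mul ((z : EuclideanSpace ℝ (Fin n)) j))
    refine (h1.mul (HasDerivAt.comp φ (hf _ (hmem φ z)) h2)).congr_deriv ?_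
    simp only [Pi.add_apply, Pi.sub_apply, Function.comp_apply]
    ring
  · rw [Set.univ_prod_univ, continuousOn_univ]
    have hC : Continuous fun w : ℝ × sphere (0 : EuclideanSpace ℝ (Fin n)) 1 ↦
        (w.2 : EuclideanSpace ℝ (Fin n)) i * Real.cos w.1
          + (w.2 : EuclideanSpace ℝ (Fin n)) j * Real.sin w.1 := by fun_prop
    have hS : Continuous fun w : ℝ × sphere (0 : EuclideanSpace ℝ (Fin n)) 1 ↦
        (w.2 : EuclideanSpace ℝ (Fin n)) i * Real.sin w.1
          - (w.2 : EuclideanSpace ℝ (Fin n)) j * Real.cos w.1 := by fun_prop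
    exact (hC.mul (hfc.comp_continuous hC fun w ↦ hmem w.1 w.2)).add
      (hS.mul ((hf'.comp_continuous hC fun w ↦ hmem w.1 w.2).mul hS.neg))

/-- Integration by parts for zonal functions, the sum over `j ≠ i` of the previous identities. -/
lemma integral_sphere_zonal_by_parts {n : ℕ} (i : Fin n)
    {f f' : ℝ → ℝ} (hf : ∀ t ∈ Set.Icc (-1 : ℝ) 1, HasDerivAt f (f' t) t)
    (hf' : ContinuousOn f' (Set.Icc (-1) 1)) :
    ((n : ℝ) - 1) * ∫ z : sphere (0 : EuclideanSpace ℝ (Fin n)) 1,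
        (z : EuclideanSpace ℝ (Fin n)) i * f ((z : EuclideanSpace ℝ (Fin n)) i)
          ∂normalizedSphereMeasure n =
      ∫ z : sphere (0 : EuclideanSpace ℝ (Fin n)) 1,
        (1 - (z : EuclideanSpace ℝ (Fin n)) i ^ 2) * f' ((z : EuclideanSpace ℝ (Fin n)) i)
          ∂normalizedSphereMeasure n := by
  have hcoord : ∀ k : Fin n, Continuous fun z : sphere (0 : EuclideanSpace ℝ (Fin n)) 1 ↦
      (z : EuclideanSpace ℝ (Fin n)) k := fun k ↦ by fun_prop
  have hsum : ∀ z : sphere (0 : EuclideanSpace ℝ (Fin n)) 1,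
      (1 - (z : EuclideanSpace ℝ (Fin n)) i ^ 2) * f' ((z : EuclideanSpace ℝ (Fin n)) i) =
        ∑ j ∈ Finset.univ.erase i,
          (z : EuclideanSpace ℝ (Fin n)) j ^ 2 * f' ((z : EuclideanSpace ℝ (Fin n)) i) := by
    intro z
    have h1 : ∑ j, (z : EuclideanSpace ℝ (Fin n)) j ^ 2 = 1 := by
      rw [← EuclideanSpace.real_norm_sq_eq, norm_eq_of_mem_sphere, one_pow]
    rw [← Finset.add_sum_erase _ _ (Finset.mem_univ i)] at h1
    rw [← Finset.sum_mul, eq_sub_of_add_eq' h1]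
  simp only [hsum]
  rw [integral_finsetSum]
  · rw [Finset.sum_congr rfl fun j hj ↦
      (integral_sphere_coord_mul_eq_integral_sq_mul_deriv (Finset.ne_of_mem_erase hj).symm
        hf hf').symm, Finset.sum_const, Finset.card_erase_of_mem (Finset.mem_univ i),
      Finset.card_univ, Fintype.card_fin, nsmul_eq_mul, Nat.cast_pred i.pos]
  · intro j _
    exact (((hcoord j).pow 2).mul (hf'.comp_continuous (hcoord i)
      fun z ↦ sphere_coord_mem_Icc z i)).integrable_of_hasCompactSupport
      (HasCompactSupport.of_compactSpace _)

/-! ### Zonal moments -/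

/-- The moment `∫ zᵢᵏ |eᵢ - a z|²ᵉ dσ(z)`, where `|eᵢ - a z|² = 1 + a² - 2 a zᵢ` on the unit
sphere. -/
noncomputable def zonalMoment (n : ℕ) (i : Fin n) (k : ℕ) (e a : ℝ) : ℝ :=
  ∫ z : sphere (0 : EuclideanSpace ℝ (Fin n)) 1,
    (z : EuclideanSpace ℝ (Fin n)) i ^ k *
      (1 + a ^ 2 - 2 * a * (z : EuclideanSpace ℝ (Fin n)) i) ^ e ∂normalizedSphereMeasure n

lemma zonal_base_pos {a t : ℝ} (ha : a ∈ Set.Ioo (-1 : ℝ) 1) (ht : t ∈ Set.Icc (-1 : ℝ) 1) :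
    0 < 1 + a ^ 2 - 2 * a * t := by
  have h1 : 0 < (1 + a) ^ 2 := by have := ha.1; positivity [show 0 < 1 + a by linarith]
  have h2 : 0 < (1 - a) ^ 2 := pow_pos (by linarith [ha.2]) 2
  rcases eq_or_lt_of_le ht.1 with rfl | h
  · nlinarith
  · nlinarith [mul_pos h2 (show 0 < 1 + t by linarith),
      mul_nonneg h1.le (show 0 ≤ 1 - t by linarith [ht.2])]

lemma continuous_zonal {n : ℕ} (i : Fin n) (k : ℕ) (e : ℝ) {a : ℝ} (ha : a ∈ Set.Ioo (-1 : ℝ) 1) :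
    Continuous fun z : sphere (0 : EuclideanSpace ℝ (Fin n)) 1 ↦
      (z : EuclideanSpace ℝ (Fin n)) i ^ k *
        (1 + a ^ 2 - 2 * a * (z : EuclideanSpace ℝ (Fin n)) i) ^ e :=
  .mul (by fun_prop) (.rpow_const (by fun_prop) fun z ↦
    .inl (zonal_base_pos ha (sphere_coord_mem_Icc z i)).ne')

lemma integrable_zonal {n : ℕ} (i : Fin n) (k : ℕ) (e : ℝ) {a : ℝ}
    (ha : a ∈ Set.Ioo (-1 : ℝ) 1) :
    Integrable (fun z : sphere (0 : EuclideanSpace ℝ (Fin n)) 1 ↦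
      (z : EuclideanSpace ℝ (Fin n)) i ^ k *
        (1 + a ^ 2 - 2 * a * (z : EuclideanSpace ℝ (Fin n)) i) ^ e) (normalizedSphereMeasure n) :=
  (continuous_zonal i k e ha).integrable_of_hasCompactSupport (HasCompactSupport.of_compactSpace _)

lemma zonalMoment_add_one {n : ℕ} (i : Fin n) (k : ℕ) (e : ℝ) {a : ℝ}
    (ha : a ∈ Set.Ioo (-1 : ℝ) 1) :
    zonalMoment n i k (e + 1) a =
      (1 + a ^ 2) * zonalMoment n i k e a - 2 * a * zonalMoment n i (k + 1) e a := by
  unfold zonalMoment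
  rw [← integral_const_mul, ← integral_const_mul, ← integral_sub
    ((integrable_zonal i k e ha).const_mul _) ((integrable_zonal i (k + 1) e ha).const_mul _)]
  congr 1 with z
  rw [Real.rpow_add_one (zonal_base_pos ha (sphere_coord_mem_Icc z i)).ne']
  ring

lemma hasDerivAt_zonalMoment {n : ℕ} (i : Fin n) (k : ℕ) (e : ℝ) {a : ℝ}
    (ha : a ∈ Set.Ioo (-1 : ℝ) 1) :
    HasDerivAt (zonalMoment n i k e)
      (2 * e * (a * zonalMoment n i k (e - 1) a - zonalMoment n i (k + 1) (e - 1) a)) a := by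
  have h := hasDerivAt_integral_of_compactSpace (normalizedSphereMeasure n) isOpen_Ioo
    (g := fun b z ↦ (z : EuclideanSpace ℝ (Fin n)) i ^ k *
        (1 + b ^ 2 - 2 * b * (z : EuclideanSpace ℝ (Fin n)) i) ^ e)
    (g' := fun b z ↦ (z : EuclideanSpace ℝ (Fin n)) i ^ k *
        ((2 * b - 2 * (z : EuclideanSpace ℝ (Fin n)) i) * e *
          (1 + b ^ 2 - 2 * b * (z : EuclideanSpace ℝ (Fin n)) i) ^ (e - 1)))
    (fun b hb ↦ continuous_zonal i k e hb) ?_ ?_ ha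
  · refine h.congr_deriv ?_
    unfold zonalMoment
    rw [← integral_const_mul, ← integral_sub
      ((integrable_zonal i k (e - 1) ha).const_mul _) (integrable_zonal i (k + 1) (e - 1) ha),
      ← integral_const_mul]
    congr 1 with z
    ring
  · intro b hb z
    have hX : HasDerivAt (fun b : ℝ ↦ 1 + b ^ 2 - 2 * b * (z : EuclideanSpace ℝ (Fin n)) i)
        (2 * b - 2 * (z : EuclideanSpace ℝ (Fin n)) i) b := by
      refine ((((hasDerivAt_id b).pow 2).const_add 1).sub
        (((hasDerivAt_id b).const_mul 2).mul_const _)).congr_deriv ?_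
      simp
    exact (hX.rpow_const (.inl (zonal_base_pos hb (sphere_coord_mem_Icc z i)).ne')).const_mul _
  · refine ContinuousOn.mul (by fun_prop) (ContinuousOn.mul (by fun_prop)
      (ContinuousOn.rpow_const (by fun_prop) fun w hw ↦
        .inl (zonal_base_pos hw.1 (sphere_coord_mem_Icc w.2 i)).ne'))

/-- The only linear relation among the moments that reflects the dimension: integration by parts
applied to `t ↦ (1 + a² - 2 a t) ^ e`. -/
lemma zonalMoment_by_parts {n : ℕ} (i : Fin n) (e : ℝ) {a : ℝ} (ha : a ∈ Set.Ioo (-1 : ℝ) 1) :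
    ((n : ℝ) - 1) * zonalMoment n i 1 e a =
      -2 * a * e * (zonalMoment n i 0 (e - 1) a - zonalMoment n i 2 (e - 1) a) := by
  have h := integral_sphere_zonal_by_parts i (f := fun t ↦ (1 + a ^ 2 - 2 * a * t) ^ e)
    (f' := fun t ↦ -(2 * a) * e * (1 + a ^ 2 - 2 * a * t) ^ (e - 1)) ?_ ?_
  · unfold zonalMoment
    simp only [pow_one]
    rw [h, ← integral_sub (integrable_zonal i 0 (e - 1) ha) (integrable_zonal i 2 (e - 1) ha),
      ← integral_const_mul]
    congr 1 with z
    ring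
  · intro t ht
    have hX : HasDerivAt (fun t : ℝ ↦ 1 + a ^ 2 - 2 * a * t) (-(2 * a)) t := by
      refine (((hasDerivAt_id t).const_mul (2 * a)).const_sub (1 + a ^ 2)).congr_deriv ?_
      simp
    exact hX.rpow_const (.inl (zonal_base_pos ha ht).ne')
  · exact ContinuousOn.mul (by fun_prop) (ContinuousOn.rpow_const (by fun_prop) fun t ht ↦
      .inl (zonal_base_pos ha ht).ne')

lemma zonalMoment_zero_nonneg {n : ℕ} (i : Fin n) (e : ℝ) {a : ℝ} (ha : a ∈ Set.Ioo (-1 : ℝ) 1) :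
    0 ≤ zonalMoment n i 0 e a :=
  integral_nonneg fun z ↦ mul_nonneg (by simp)
    (Real.rpow_nonneg (zonal_base_pos ha (sphere_coord_mem_Icc z i)).le _)

lemma zonalMoment_zero_zero {n : ℕ} (i : Fin n) (e : ℝ) : zonalMoment n i 0 e 0 = 1 := by
  have := isProbabilityMeasure_normalizedSphereMeasure i.pos
  simp [zonalMoment]

lemma zonalMoment_one_zero {n : ℕ} (hn : 2 ≤ n) (i : Fin n) (e : ℝ) :
    zonalMoment n i 1 e 0 = 0 := by
  have h := zonalMoment_by_parts i e (a := 0) (by simp)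
  have hn' : (2 : ℝ) ≤ n := by exact_mod_cast hn
  simp only [mul_zero, zero_mul, mul_eq_zero] at h
  exact h.resolve_left (by linarith)

/-- Each coordinate has second moment `1 / n` on the sphere. -/
lemma zonalMoment_two_zero {n : ℕ} (i : Fin n) (e : ℝ) : zonalMoment n i 2 e 0 = 1 / n := by
  have := isProbabilityMeasure_normalizedSphereMeasure i.pos
  have hn : (n : ℝ) ≠ 0 := by exact_mod_cast i.pos.ne'
  have hint : Integrable (fun z : sphere (0 : EuclideanSpace ℝ (Fin n)) 1 ↦
      (z : EuclideanSpace ℝ (Fin n)) i ^ 2) (normalizedSphereMeasure n) := by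
    simpa using integrable_zonal i 2 0 (a := 0) (by simp)
  have h := integral_sphere_zonal_by_parts i (f := fun t ↦ t) (f' := fun _ ↦ 1)
    (fun t _ ↦ hasDerivAt_id t) continuousOn_const
  simp only [mul_one, ← pow_two] at h
  rw [integral_sub (integrable_const _) hint] at h
  simp only [integral_const, probReal_univ, smul_eq_mul, mul_one] at h
  simp only [zonalMoment, ne_eq, OfNat.ofNat_ne_zero, not_false_eq_true, zero_pow, add_zero,
    mul_zero, zero_mul, sub_zero, Real.one_rpow, mul_one]
  field_simp
  linarith

/-! ### The comparison argument -/

/-- The quantity `(1 - lam) a M₀ - (1 - lam a²) M₁`, with `Mₖ` the zonal moments of exponent `e`.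
It is, up to a positive factor, the logarithmic derivative of
`M₀(e + 1) / (1 + lam a²) ^ (e + 1)`. -/
noncomputable def zonalDefect (n : ℕ) (i : Fin n) (lam e a : ℝ) : ℝ :=
  (1 - lam) * a * zonalMoment n i 0 e a - (1 - lam * a ^ 2) * zonalMoment n i 1 e a

/-- With `e = q - 1` and `n lam = n + 2 e`, i.e. `e = -n (1 - lam) / 2`, the second order equation
satisfied by the spherical means turns into a first order linear equation for the defect, with a
nonnegative inhomogeneity. -/
lemma exists_hasDerivAt_zonalDefect {n : ℕ} (i : Fin n) {lam e a : ℝ}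
    (he : (n : ℝ) * lam = n + 2 * e) (ha : a ∈ Set.Ioo (-1 : ℝ) 1) :
    ∃ d, HasDerivAt (zonalDefect n i lam e) d a ∧
      a * (1 - a ^ 2) * (1 + lam * a ^ 2) * d =
        -((n - 1 + (n + 1 + 4 * e) * a ^ 2) * (1 + lam * a ^ 2)
          + 2 * e * lam * a ^ 2 * (1 - a ^ 2)) * zonalDefect n i lam e a
        - 2 * e * lam * (1 + lam) * a ^ 3 * zonalMoment n i 0 (e + 1) a := by
  have hA := hasDerivAt_zonalMoment i 0 e ha
  have hB := hasDerivAt_zonalMoment i 1 e ha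
  have h := (((hasDerivAt_id a).const_mul (1 - lam)).mul hA).sub
    (((((hasDerivAt_id a).pow 2).const_mul lam).const_sub 1).mul hB)
  refine ⟨_, h, ?_⟩
  have rA := zonalMoment_add_one i 0 (e - 1) ha
  have rB := zonalMoment_add_one i 1 (e - 1) ha
  have rF := zonalMoment_add_one i 0 e ha
  have rP := zonalMoment_by_parts i e ha
  rw [sub_add_cancel] at rA rB
  simp only [zero_add, one_add_one_eq_two, Nat.cast_ofNat, id, Nat.add_one_sub_one, pow_one,
    mul_one, Pi.pow_apply, zonalDefect] at rA rB rF rP ⊢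
  rw [rB] at rP
  rw [rF, rA, rB]
  obtain rfl : e = (n * lam - n) / 2 := by linarith
  -- All moments are now of exponent `e - 1` and the only relation among them is `rP`; its
  -- multiplier is found by comparing the coefficients of the moment with `k = 0`.
  linear_combination (-((1 - a ^ 2) * (1 + lam * a ^ 2) * (-(1 - lam) * a ^ 2) + (1 + a ^ 2) *
    ((1 + a ^ 2 - 2 * (1 - lam) * a ^ 2) * (1 + lam * a ^ 2)
      - (1 - lam) * lam * a ^ 2 * (1 - a ^ 2))) +
    lam * a ^ 2 * (1 + lam) * (1 + a ^ 2) ^ 2) * rP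

lemma hasDerivAt_zonalMoment_one_zero {n : ℕ} (i : Fin n) (e : ℝ) :
    HasDerivAt (zonalMoment n i 1 e) (-2 * e / n) 0 := by
  refine (hasDerivAt_zonalMoment i 1 e (a := 0) (by simp)).congr_deriv ?_
  rw [one_add_one_eq_two, zonalMoment_two_zero]
  ring

lemma hasDerivAt_zonalDefect_zero {n : ℕ} (i : Fin n) {lam e : ℝ}
    (he : (n : ℝ) * lam = n + 2 * e) : HasDerivAt (zonalDefect n i lam e) 0 0 := by
  have hn : (n : ℝ) ≠ 0 := by exact_mod_cast i.pos.ne'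
  have h := (((hasDerivAt_id (0 : ℝ)).const_mul (1 - lam)).mul
    (hasDerivAt_zonalMoment i 0 e (a := 0) (by simp))).sub
    (((((hasDerivAt_id (0 : ℝ)).pow 2).const_mul lam).const_sub 1).mul
      (hasDerivAt_zonalMoment_one_zero i e))
  refine h.congr_deriv ?_
  simp only [zonalMoment_zero_zero, id]
  field_simp
  simp
  linarith

/-- The defect cannot become negative: wherever it is negative the differential equation makes it
increase, and it starts from `0`. -/
lemma zonalDefect_nonneg {n : ℕ} (hn : 2 ≤ n) (i : Fin n) {lam e : ℝ} (he1 : -1 < e) (he0 : e ≤ 0)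
    (he : (n : ℝ) * lam = n + 2 * e) {a : ℝ} (ha0 : 0 ≤ a) (ha1 : a < 1) :
    0 ≤ zonalDefect n i lam e a := by
  have hn' : (2 : ℝ) ≤ n := by exact_mod_cast hn
  have hlam0 : 0 < lam := by
    by_contra! h
    nlinarith
  have hlam1 : lam ≤ 1 := by
    by_contra! h
    nlinarith
  have hmem : ∀ x ∈ Set.Icc 0 a, x ∈ Set.Ioo (-1 : ℝ) 1 := fun x hx ↦
    ⟨by linarith [hx.1], hx.2.trans_lt ha1⟩
  -- The linear barrier `-ε x` is strict also at the singular point `0` of the equation.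
  have hbarrier : ∀ ε > 0, -zonalDefect n i lam e a ≤ ε * a := by
    intro ε hε
    have hd : ∀ x ∈ Set.Icc 0 a, HasDerivAt (fun x ↦ -zonalDefect n i lam e x)
        (-deriv (zonalDefect n i lam e) x) x := by
      intro x hx
      obtain ⟨d, hd, -⟩ := exists_hasDerivAt_zonalDefect i he (hmem x hx)
      rw [hd.deriv]
      exact hd.neg
    refine image_le_of_deriv_right_lt_deriv_boundary (B := fun x ↦ ε * x) (B' := fun _ ↦ ε)
      (fun x hx ↦ (hd x hx).continuousAt.continuousWithinAt)
      (fun x hx ↦ (hd x (Set.Ico_subset_Icc_self hx)).hasDerivWithinAt) ?_ (fun x ↦ ?_) ?_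
      (Set.right_mem_Icc.2 ha0)
    · simp [zonalDefect, zonalMoment_one_zero hn]
    · simpa using (hasDerivAt_id x).const_mul ε
    · intro x hx hxe
      rcases hx.1.eq_or_lt with rfl | hx0
      · rw [(hasDerivAt_zonalDefect_zero i he).deriv]
        simpa using hε
      · have hxm := hmem x (Set.Ico_subset_Icc_self hx)
        obtain ⟨d, hd, hode⟩ := exists_hasDerivAt_zonalDefect i he hxm
        rw [hd.deriv]
        have hs0 : 0 < x ^ 2 := by positivity
        have hs1 : x ^ 2 < 1 := by nlinarith [hxm.2]
        have hF := zonalMoment_zero_nonneg i (e + 1) hxm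
        have hP : 0 < (n - 1 + (n + 1 + 4 * e) * x ^ 2) * (1 + lam * x ^ 2)
            + 2 * e * lam * x ^ 2 * (1 - x ^ 2) := by
          have h1 : 1 - x ^ 2 ≤ n - 1 + (n + 1 + 4 * e) * x ^ 2 := by nlinarith
          have h2 : (1 - x ^ 2) * (1 + lam * x ^ 2) ≤
              (n - 1 + (n + 1 + 4 * e) * x ^ 2) * (1 + lam * x ^ 2) :=
            mul_le_mul_of_nonneg_right h1 (by positivity)
          have h3 : 0 ≤ (1 + e) * (lam * x ^ 2 * (1 - x ^ 2)) :=
            mul_nonneg (by linarith) (mul_nonneg (by positivity) (by linarith))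
          have h4 : 0 < (1 - x ^ 2) * (1 - lam * x ^ 2) :=
            mul_pos (by linarith) (by nlinarith)
          linarith
        have hD : zonalDefect n i lam e x = -(ε * x) := by linarith
        have hQ : 0 ≤ -e * (2 * lam * (1 + lam) * x ^ 3 * zonalMoment n i 0 (e + 1) x) :=
          mul_nonneg (by linarith) (mul_nonneg (by positivity) hF)
        have hpos : 0 < x * (1 - x ^ 2) * (1 + lam * x ^ 2) * d := by
          rw [hode, hD]
          linarith [mul_pos hP (mul_pos hε hx0)]
        have : 0 < d := by
          refine (mul_pos_iff_of_pos_left ?_).1 hpos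
          exact mul_pos (mul_pos hx0 (by linarith)) (by positivity)
        linarith
  by_contra! h
  have := hbarrier (-zonalDefect n i lam e a / 2) (by linarith)
  nlinarith

lemma continuous_zonalMoment_zero {n : ℕ} (i : Fin n) {q : ℝ} (hq : 0 ≤ q) :
    Continuous (zonalMoment n i 0 q) := by
  unfold zonalMoment
  simp_rw [← setIntegral_univ (μ := normalizedSphereMeasure n)]
  refine continuous_parametric_integral_of_continuous ?_ isCompact_univ
  exact .mul (by fun_prop) (.rpow_const (by fun_prop) fun _ ↦ .inr hq)

/-- The inequality for a unit vector `x` and `0 ≤ a ≤ 1`. -/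
lemma rpow_le_zonalMoment {n : ℕ} (hn : 2 ≤ n) (i : Fin n) {lam q : ℝ} (hq0 : 0 < q) (hq1 : q ≤ 1)
    (hlam : (n : ℝ) * lam = n + 2 * (q - 1)) {a : ℝ} (ha : a ∈ Set.Icc (0 : ℝ) 1) :
    (1 + lam * a ^ 2) ^ q ≤ zonalMoment n i 0 q a := by
  have hn' : (2 : ℝ) ≤ n := by exact_mod_cast hn
  have hlam0 : 0 < lam := by
    by_contra! h
    nlinarith
  have hbase : ∀ a : ℝ, 0 < 1 + lam * a ^ 2 := fun a ↦ by positivity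
  -- The quotient of the two sides is monotone on `[0, 1)`.
  have hd : ∀ x ∈ Set.Ioo (-1 : ℝ) 1, HasDerivAt
      (fun x ↦ zonalMoment n i 0 q x * (1 + lam * x ^ 2) ^ (-q))
      (2 * q * (1 + lam * x ^ 2) ^ (-q - 1) * zonalDefect n i lam (q - 1) x) x := by
    intro x hx
    have h1 : HasDerivAt (fun x : ℝ ↦ 1 + lam * x ^ 2) (2 * lam * x) x := by
      refine ((((hasDerivAt_id x).pow 2).const_mul lam).const_add 1).congr_deriv ?_
      simp
      ring
    refine ((hasDerivAt_zonalMoment i 0 q hx).mul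
      (h1.rpow_const (p := -q) (.inl (hbase x).ne'))).congr_deriv ?_
    have rF := zonalMoment_add_one i 0 (q - 1) hx
    have rp : (1 + lam * x ^ 2) ^ (-q) = (1 + lam * x ^ 2) ^ (-q - 1) * (1 + lam * x ^ 2) := by
      rw [← Real.rpow_add_one (hbase x).ne', sub_add_cancel]
    rw [sub_add_cancel] at rF
    rw [rF, rp, zonalDefect, zero_add]
    ring
  have hmono : MonotoneOn (fun x ↦ zonalMoment n i 0 q x * (1 + lam * x ^ 2) ^ (-q))
      (Set.Ico 0 1) := by
    refine monotoneOn_of_hasDerivWithinAt_nonneg (convex_Ico 0 1)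
      (fun x hx ↦ (hd x ⟨by linarith [hx.1], hx.2⟩).continuousAt.continuousWithinAt)
      (fun x hx ↦ (hd x ?_).hasDerivWithinAt) fun x hx ↦ ?_
    · rw [interior_Ico] at hx
      exact ⟨by linarith [hx.1], hx.2⟩
    · rw [interior_Ico] at hx
      exact mul_nonneg (mul_nonneg (by linarith) (Real.rpow_nonneg (hbase x).le _))
        (zonalDefect_nonneg hn i (by linarith) (by linarith) hlam hx.1.le hx.2)
  have hIco : ∀ x ∈ Set.Ico (0 : ℝ) 1, (1 + lam * x ^ 2) ^ q ≤ zonalMoment n i 0 q x := by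
    intro x hx
    have h := hmono (Set.left_mem_Ico.2 one_pos) hx hx.1
    simp only [zonalMoment_zero_zero, ne_eq, OfNat.ofNat_ne_zero, not_false_eq_true, zero_pow,
      mul_zero, add_zero, Real.one_rpow, mul_one] at h
    rw [Real.rpow_neg (hbase x).le, ← div_eq_mul_inv,
      one_le_div (Real.rpow_pos_of_pos (hbase x) _)] at h
    exact h
  rw [← closure_Ico (zero_ne_one' ℝ)] at ha
  refine le_on_closure hIco ?_ (continuous_zonalMoment_zero i hq0.le).continuousOn ha
  exact ContinuousOn.rpow_const (by fun_prop) fun x _ ↦ .inl (hbase x).ne'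

/-! ### Spherical means of powers of the distance -/

/-- The spherical mean depends on `x` only through its norm, hence is a zonal integral. -/
lemma integral_sphere_norm_sub_smul_rpow {n : ℕ} (i : Fin n) {p : ℝ} (hp : 0 ≤ p)
    (x : EuclideanSpace ℝ (Fin n)) (a : ℝ) :
    ∫ z : sphere (0 : EuclideanSpace ℝ (Fin n)) 1,
        ‖x - a • (z : EuclideanSpace ℝ (Fin n))‖ ^ p ∂normalizedSphereMeasure n =
      ∫ z : sphere (0 : EuclideanSpace ℝ (Fin n)) 1,
        (‖x‖ ^ 2 + a ^ 2 - 2 * (‖x‖ * a) * (z : EuclideanSpace ℝ (Fin n)) i) ^ (p / 2)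
          ∂normalizedSphereMeasure n := by
  set y : EuclideanSpace ℝ (Fin n) := EuclideanSpace.single i ‖x‖
  have hy : ‖y‖ = ‖x‖ := by simp [y]
  set L := (Submodule.span ℝ {y - x})ᗮ.reflection
  have hL : L y = x := Submodule.reflection_sub hy
  rw [← integral_sphere_comp_linearIsometryEquiv L (g := fun z ↦ ‖x - a • z‖ ^ p)
    (.rpow_const (by fun_prop) fun _ ↦ .inr hp)]
  congr 1 with z
  have h : ‖x - a • L z‖ ^ 2 =
      ‖x‖ ^ 2 + a ^ 2 - 2 * (‖x‖ * a) * (z : EuclideanSpace ℝ (Fin n)) i := by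
    rw [← hL, ← map_smul, ← map_sub, L.norm_map, L.norm_map, norm_sub_sq_real, norm_smul,
      norm_eq_of_mem_sphere, inner_smul_right, EuclideanSpace.inner_single_left, hy]
    simp
    ring
  rw [← h, ← Real.rpow_natCast, ← Real.rpow_mul (norm_nonneg _)]
  congr 1
  push_cast
  ring

/-- The inequality for `a ≤ r`, obtained from the case `r = 1` by homogeneity. -/
lemma rpow_le_integral_sphere_of_le {n : ℕ} (hn : 2 ≤ n) (i : Fin n) {lam q : ℝ} (hq0 : 0 < q)
    (hq1 : q ≤ 1) (hlam : (n : ℝ) * lam = n + 2 * (q - 1)) {r a : ℝ} (ha : 0 ≤ a) (har : a ≤ r) :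
    (r ^ 2 + lam * a ^ 2) ^ q ≤
      ∫ z : sphere (0 : EuclideanSpace ℝ (Fin n)) 1,
        (r ^ 2 + a ^ 2 - 2 * (r * a) * (z : EuclideanSpace ℝ (Fin n)) i) ^ q
          ∂normalizedSphereMeasure n := by
  rcases (ha.trans har).eq_or_lt with rfl | hr
  · obtain rfl : a = 0 := le_antisymm har ha
    simp [Real.zero_rpow hq0.ne']
  have hscale : ∀ t : ℝ, 0 ≤ t → (r ^ 2) ^ q * t ^ q = (r ^ 2 * t) ^ q :=
    fun t ht ↦ (Real.mul_rpow (by positivity) ht).symm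
  have hn' : (2 : ℝ) ≤ n := by exact_mod_cast hn
  have hlam0 : 0 ≤ lam := by
    by_contra! h
    nlinarith
  have h := mul_le_mul_of_nonneg_left (rpow_le_zonalMoment hn i hq0 hq1 hlam (a := a / r)
    ⟨by positivity, (div_le_one hr).2 har⟩) (show 0 ≤ (r ^ 2) ^ q by positivity)
  rw [zonalMoment, ← integral_const_mul, hscale _ (by positivity)] at h
  refine (le_of_eq ?_).trans (h.trans (le_of_eq (integral_congr_ae (.of_forall fun z ↦ ?_))))
  · congr 1
    field_simp
  · have hz := sphere_coord_mem_Icc z i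
    beta_reduce
    rw [pow_zero, one_mul, hscale]
    · congr 1
      field_simp
    · nlinarith [sq_nonneg (a / r - (z : EuclideanSpace ℝ (Fin n)) i), hz.1, hz.2]

lemma sphericalConvexityInequality_of_le {n : ℕ} (hn : 2 ≤ n) {p : ℝ} (hp0 : 0 < p) (hp2 : p ≤ 2)
    {lam : ℝ} (hlam : lam ≤ ((n : ℝ) + p - 2) / n) : SphericalConvexityInequality n p lam := by
  intro x a ha hx
  have hn' : (2 : ℝ) ≤ n := by exact_mod_cast hn
  set l : ℝ := ((n : ℝ) + p - 2) / n with hl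
  have hl1 : l ≤ 1 := (div_le_one (by linarith)).2 (by linarith)
  have hnl : (n : ℝ) * l = n + 2 * (p / 2 - 1) := by
    rw [hl]
    field_simp
    ring
  let i : Fin n := ⟨0, by omega⟩
  rw [integral_sphere_norm_sub_smul_rpow i hp0.le]
  refine (Real.rpow_le_rpow hx (z := p / 2)
    (add_le_add_right (mul_le_mul_of_nonneg_right hlam (sq_nonneg a)) (‖x‖ ^ 2))
    (by positivity)).trans ?_
  rcases le_total a ‖x‖ with hax | hax
  · exact rpow_le_integral_sphere_of_le hn i (by linarith) (by linarith) hnl ha hax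
  · -- The spherical mean is symmetric in `‖x‖` and `a`, and as `l ≤ 1` the bound with the two
    -- exchanged is the larger one when `‖x‖ ≤ a`.
    have h := rpow_le_integral_sphere_of_le hn i (by linarith) (by linarith) hnl (norm_nonneg x) hax
    simp only [add_comm (a ^ 2) (‖x‖ ^ 2), mul_comm a ‖x‖] at h
    refine (Real.rpow_le_rpow ?_ ?_ (by positivity)).trans h
    · exact hx.trans
        (add_le_add_right (mul_le_mul_of_nonneg_right hlam (sq_nonneg a)) (‖x‖ ^ 2))
    · nlinarith [pow_le_pow_left₀ (norm_nonneg x) hax 2]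

/-- Sharpness: both sides agree to first order in `a` at `x = eᵢ`, `a = 0`, and comparing the next
order bounds the constant. -/
lemma le_of_sphericalConvexityInequality {n : ℕ} (hn : 2 ≤ n) {p : ℝ} (hp0 : 0 < p)
    {lam : ℝ} (h : SphericalConvexityInequality n p lam) : lam ≤ ((n : ℝ) + p - 2) / n := by
  by_contra! hlt
  have hn' : (2 : ℝ) ≤ n := by exact_mod_cast hn
  have hlam0 : 0 < lam := hlt.trans_le' (div_nonneg (by linarith) (by linarith))
  have hbase : ∀ a : ℝ, 0 < 1 + lam * a ^ 2 := fun a ↦ by positivity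
  let i : Fin n := ⟨0, by omega⟩
  have hle : ∀ a : ℝ, 0 ≤ a → (1 + lam * a ^ 2) ^ (p / 2) ≤ zonalMoment n i 0 (p / 2) a := by
    intro a ha
    have h1 := h (EuclideanSpace.single i 1) a ha (by simpa using (hbase a).le)
    rw [integral_sphere_norm_sub_smul_rpow i hp0.le] at h1
    simpa [zonalMoment] using h1
  -- Up to the factor `p`, this is the derivative of the difference of the two sides.
  set ψ : ℝ → ℝ := fun a ↦ a * zonalMoment n i 0 (p / 2 - 1) a - zonalMoment n i 1 (p / 2 - 1) a
    - lam * a * (1 + lam * a ^ 2) ^ (p / 2 - 1) with hψ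
  have hbase' : ∀ a : ℝ, HasDerivAt (fun a : ℝ ↦ 1 + lam * a ^ 2) (2 * lam * a) a := by
    intro a
    refine ((((hasDerivAt_id a).pow 2).const_mul lam).const_add 1).congr_deriv ?_
    simp
    ring
  have hψ0 : ψ 0 = 0 := by simp [hψ, zonalMoment_one_zero hn]
  have hψ' : HasDerivAt ψ (((n : ℝ) + p - 2) / n - lam) 0 := by
    refine ((((hasDerivAt_id (0 : ℝ)).mul
      (hasDerivAt_zonalMoment i 0 (p / 2 - 1) (a := 0) (by simp))).sub
      (hasDerivAt_zonalMoment_one_zero i (p / 2 - 1))).sub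
      (((hasDerivAt_id (0 : ℝ)).const_mul lam).mul
        ((hbase' 0).rpow_const (p := p / 2 - 1) (.inl (hbase 0).ne')))).congr_deriv ?_
    simp [zonalMoment_zero_zero]
    field_simp
    ring
  have hneg : ∀ᶠ a in nhdsWithin (0 : ℝ) (Set.Ioi 0), ψ a < 0 := by
    have h1 := (hψ'.hasDerivWithinAt (s := Set.Ioi 0)).limsup_slope_le' (by simp)
      (sub_neg.2 hlt)
    filter_upwards [h1, self_mem_nhdsWithin] with a ha ha0
    rw [slope_def_field, hψ0, sub_zero, sub_zero] at ha
    exact (div_neg_iff.1 ha).resolve_left (fun h ↦ absurd ha0 (not_lt.2 h.2.le)) |>.1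
  obtain ⟨δ, hδ0, hδ⟩ := (mem_nhdsGT_iff_exists_Ioo_subset).1 hneg
  have hδ0' : (0 : ℝ) < δ := hδ0
  set c := min δ 1 / 2 with hc
  have hc0 : 0 < c := by positivity
  have hcδ : c < δ := by linarith [min_le_left δ 1]
  have hc1 : c < 1 := by linarith [min_le_right δ 1]
  have hd : ∀ x ∈ Set.Icc 0 c, HasDerivAt
      (fun a ↦ zonalMoment n i 0 (p / 2) a - (1 + lam * a ^ 2) ^ (p / 2)) (p * ψ x) x := by
    intro x hx
    refine ((hasDerivAt_zonalMoment i 0 (p / 2) ⟨by linarith [hx.1], hx.2.trans_lt hc1⟩).sub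
      ((hbase' x).rpow_const (p := p / 2) (.inl (hbase x).ne'))).congr_deriv ?_
    simp only [hψ]
    ring
  have hanti := strictAntiOn_of_hasDerivWithinAt_neg (convex_Icc 0 c)
    (fun x hx ↦ (hd x hx).continuousAt.continuousWithinAt)
    (fun x hx ↦ (hd x (interior_subset hx)).hasDerivWithinAt) fun x hx ↦ by
      rw [interior_Icc] at hx
      exact mul_neg_of_pos_of_neg hp0 (hδ ⟨hx.1, hx.2.trans hcδ⟩)
  have := hanti (Set.left_mem_Icc.2 hc0.le) (Set.right_mem_Icc.2 hc0.le) hc0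
  simp only [zonalMoment_zero_zero] at this
  norm_num at this
  linarith [hle c hc0.le]

theorem theorem1 (n : ℕ) (hn : 2 ≤ n) (p : ℝ) (hp0 : 0 < p) (hp2 : p ≤ 2) :
    (∀ lam : ℝ, lam ≤ ((n : ℝ) + p - 2) / n → SphericalConvexityInequality n p lam) ∧
      IsGreatest {lam : ℝ | SphericalConvexityInequality n p lam} (((n : ℝ) + p - 2) / n) :=
  ⟨fun _ h ↦ sphericalConvexityInequality_of_le hn hp0 hp2 h,
    sphericalConvexityInequality_of_le hn hp0 hp2 le_rfl,
    fun _ h ↦ le_of_sphericalConvexityInequality hn hp0 h⟩
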